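/- **Theorem 6.3.** Let $a,b\in\mathbf R$ with $a<-1$ and $b\neq 0$, and let $f=\tau\circ\sigma$, $f^{-1}=\sigma\circ\tau$, where $$\sigma(x,y)=\Bigl(1-x+\frac xy,\;1-y+\frac yx\Bigr),\qquad \tau(x,y)=(x,\;bx+a+1-y).$$ Let $\mathcal X_R\supset\mathbf R^2$ be the compact real surface obtained from the real projective plane $\overline{\mathbf R^2}=\{[x:y:z]\}$ (where $(x,y)\in\mathbf R^2$ is identified with $[x:y:1]$) by blowing up the three points $[1:0:0]$, $[1:b:0]$, $[0:1:0]$ at infinity and then the point of the exceptional curve over $[0:1:0]$ that lies on the proper transform of the line $x=1$. The maps $f$ and $f^{-1}$ are extended by continuity to all points of $\mathcal X_R$ at which a continuous extension exists; the remaining points are the points of indeterminacy. For $S\subset\mathcal X_R$, $f^{\pm1}(S)$ denotes the set of images of the points of $S$ that are not indeterminate for $f^{\pm1}$, and $f^{n}(S)$, $n\in\mathbf Z$, is obtained by iterating this. "Infinity" is the set $\mathcal X_R-\mathbf R^2$. The complement in $\mathbf R^2$ of $\{x=0\}\cup\{y=0\}\cup\{(x-1)(y-1)=1\}$ has the seven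 connected components $$\begin{aligned} R_1&=\{x<0,\ y<0\},\\ R_2&=\{x>0,\ y>0,\ (x-1)(y-1)>1\}, & R_3&=\{x>0,\ y>0,\ (x-1)(y-1)<1\},\\ R_4&=\{x>0,\ y<0,\ (x-1)(y-1)>1\}, & R_5&=\{x>0,\ y<0,\ (x-1)(y-1)<1\},\\ R_6&=\{x<0,\ y>0,\ (x-1)(y-1)>1\}, & R_7&=\{x<0,\ y>0,\ (x-1)(y-1)<1\}. \end{aligned}$$ Put $U=R_1\cup R_2\cup R_3\cup R_4$ if $b>0$, $U=R_3\cup R_4\cup R_5\cup R_6\cup R_7$ if $b<0$, and $\Omega=\bigcap_{n\in\mathbf Z}f^n(U)$. If $p\in\mathcal X_R-\Omega$, then at least one of the following holds: all forward iterates $f^np$, $n\ge 0$, are defined and $f^np$ tends to infinity as $n\to+\infty$; or all backward iterates $f^{n}p$, $n\le 0$, are defined and $f^{n}p$ tends to infinity as $n\to-\infty$. Here "tends to infinity" means that the orbit eventually enters every neighbourhood of the set $\mathcal X_R-\mathbf R^2$. -/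

import Mathlib

open Filter Topology

noncomputable section

namespace BirationalPlane

/-- The involution `σ(x, y) = (1 - x + x/y, 1 - y + y/x)`; only meaningful where `x ≠ 0`, `y ≠ 0`. -/
def sigma (z : ℝ × ℝ) : ℝ × ℝ := (1 - z.1 + z.1 / z.2, 1 - z.2 + z.2 / z.1)

/-- The involution `τ(x, y) = (x, b x + a + 1 - y)`. -/
def tau (a b : ℝ) (z : ℝ × ℝ) : ℝ × ℝ := (z.1, b * z.1 + a + 1 - z.2)

/-- The set where the formula for `σ` has no vanishing denominator. -/
def sigmaDom : Set (ℝ × ℝ) := {z | z.1 ≠ 0 ∧ z.2 ≠ 0}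

/-! ### The compact surface

The surface is the real projective plane, blown up at `[1:0:0]`, `[1:b:0]`, `[0:1:0]`
(exceptional curves `V₄`, `V₅`, `V₂`) and then at the point of `V₂` that lies on the line `x = 1`
(exceptional curve `V₃`); `V₀` is the proper transform of the line at infinity.
It is realised as the closure of a graph over `ℝ²`, with `OnePoint ℝ` as the real projective line.
The functions `x`, `y`, `y - b x` are the projections from the three points that are blown up first,
and `y (x - 1) / (x² + 1)` separates the points of `V₀` (where it is the slope `y / x`) and the
points of `V₃` (where it is `t / 2` at the point approached by the conic `(x - 1)(y - 1) = t`).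
These four functions extend continuously to the blown-up surface and the points at infinity have the
following values, which for `b ≠ 0` coincide only at the points where two of these curves meet:
* `V₀` : `(∞, ∞, ∞, t)`, `t ∈ ℝ ∪ {∞}` (slope `t`);
* `V₂` : `(t, ∞, ∞, ∞)`, `t ∈ ℝ ∪ {∞}` (lines `x = t`);
* `V₃` : `(1, ∞, ∞, t / 2)`, `t ∈ ℝ ∪ {∞}` (conics `(x - 1)(y - 1) = t`);
* `V₄` : `(∞, t, ∞, 0)`, `t ∈ ℝ ∪ {∞}` (lines `y = t`);
* `V₅` : `(∞, ∞, t, b)`, `t ∈ ℝ ∪ {∞}` (lines `y = b x + t`).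

As the blown-up surface is compact and contains `ℝ²` densely, it is homeomorphic, by a map that is
the identity on `ℝ²`, to the closure below. -/

/-- The four coordinate functions on `ℝ²`. -/
def coords (b : ℝ) (z : ℝ × ℝ) : OnePoint ℝ × OnePoint ℝ × OnePoint ℝ × OnePoint ℝ :=
  (((z.1 : ℝ) : OnePoint ℝ), ((z.2 : ℝ) : OnePoint ℝ), ((z.2 - b * z.1 : ℝ) : OnePoint ℝ),
    ((z.2 * (z.1 - 1) / (z.1 ^ 2 + 1) : ℝ) : OnePoint ℝ))

/-- The compact real surface: the closure of `ℝ²`, with the subspace topology. -/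
abbrev XR (b : ℝ) : Type := ↥(closure (Set.range (coords b)))

/-- The inclusion of `ℝ²` in the surface. -/
def incl (b : ℝ) (z : ℝ × ℝ) : XR b := ⟨coords b z, subset_closure (Set.mem_range_self z)⟩

/-- Infinity: the points of the surface outside `ℝ²`. -/
def infinity (b : ℝ) : Set (XR b) := (Set.range (incl b))ᶜ

/-! ### The birational map on the surface -/

/-- `q` is the value at `p` of the extension by continuity to the surface of the map `g`, which is
given on the dense subset `D` of the plane. The points `p` for which there is no such `q` are the
points of indeterminacy. -/
def IsValue (b : ℝ) (g : ℝ × ℝ → ℝ × ℝ) (D : Set (ℝ × ℝ)) (p q : XR b) : Prop :=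
  Tendsto (fun z => incl b (g z)) (comap (incl b) (𝓝 p) ⊓ 𝓟 D) (𝓝 q)

/-- `FMaps a b p q` says that `p` is not a point of indeterminacy of `f = τ ∘ σ` and `f p = q`. -/
def FMaps (a b : ℝ) (p q : XR b) : Prop :=
  IsValue b (fun z => tau a b (sigma z)) sigmaDom p q

/-- `FInvMaps a b p q` says that `p` is not a point of indeterminacy of `f⁻¹ = σ ∘ τ` and
`f⁻¹ p = q`. -/
def FInvMaps (a b : ℝ) (p q : XR b) : Prop :=
  IsValue b (fun z => sigma (tau a b z)) (tau a b ⁻¹' sigmaDom) p q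

/-- The image of a set under `f` (of its points that are not indeterminate). -/
def fImage (a b : ℝ) (S : Set (XR b)) : Set (XR b) := {q | ∃ p ∈ S, FMaps a b p q}

/-- The image of a set under `f⁻¹` (of its points that are not indeterminate). -/
def fInvImage (a b : ℝ) (S : Set (XR b)) : Set (XR b) := {q | ∃ p ∈ S, FInvMaps a b p q}

/-! ### The regions

The connected components of the complement, in the surface, of the critical curves `y = 0` and
`(x - 1)(y - 1) = 1`, the line `x = 0` and infinity. -/

def R1 : Set (ℝ × ℝ) := {z | z.1 < 0 ∧ z.2 < 0}
def R2 : Set (ℝ × ℝ) := {z | 0 < z.1 ∧ 0 < z.2 ∧ 1 < (z.1 - 1) * (z.2 - 1)}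
def R3 : Set (ℝ × ℝ) := {z | 0 < z.1 ∧ 0 < z.2 ∧ (z.1 - 1) * (z.2 - 1) < 1}
def R4 : Set (ℝ × ℝ) := {z | 0 < z.1 ∧ z.2 < 0 ∧ 1 < (z.1 - 1) * (z.2 - 1)}
def R5 : Set (ℝ × ℝ) := {z | 0 < z.1 ∧ z.2 < 0 ∧ (z.1 - 1) * (z.2 - 1) < 1}
def R6 : Set (ℝ × ℝ) := {z | z.1 < 0 ∧ 0 < z.2 ∧ 1 < (z.1 - 1) * (z.2 - 1)}
def R7 : Set (ℝ × ℝ) := {z | z.1 < 0 ∧ 0 < z.2 ∧ (z.1 - 1) * (z.2 - 1) < 1}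

/-- The union of the regions that carry the coding. For `b > 0` these are the first four. For
`b < 0` the curves `V₄` and `V₅` change places at infinity; then `R1` (forward) and `R2` (backward)
are the regions all of whose orbits escape, and the other five carry the recurrent dynamics. -/
def codingRegion (b : ℝ) : Set (ℝ × ℝ) :=
  {z | (0 < b ∧ z ∈ R1 ∪ R2 ∪ R3 ∪ R4) ∨ (b < 0 ∧ z ∈ R3 ∪ R4 ∪ R5 ∪ R6 ∪ R7)}

/-- `Ω = ⋂ₙ fⁿ(U)` over all integers `n`, with `U` the union of the regions that carry the
coding. -/
def Omega (a b : ℝ) : Set (XR b) :=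
  ⋂ n : ℕ, (fImage a b)^[n] (incl b '' codingRegion b) ∩
    (fInvImage a b)^[n] (incl b '' codingRegion b)

/-! ### Orbits that tend to infinity -/

/-- All `fⁿ p`, `n ≥ 0`, are defined, and they tend to infinity (that is, they eventually enter
each neighbourhood of the set of points at infinity) as `n → +∞`. -/
def ForwardToInfinity (a b : ℝ) (p : XR b) : Prop :=
  ∃ u : ℕ → XR b, u 0 = p ∧ (∀ n, FMaps a b (u n) (u (n + 1))) ∧
    Tendsto u atTop (𝓝ˢ (infinity b))

/-- All `fⁿ p`, `n ≤ 0`, are defined, and they tend to infinity as `n → -∞`. -/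
def BackwardToInfinity (a b : ℝ) (p : XR b) : Prop :=
  ∃ u : ℕ → XR b, u 0 = p ∧ (∀ n, FInvMaps a b (u n) (u (n + 1))) ∧
    Tendsto u atTop (𝓝ˢ (infinity b))

/-! ### Sanity facts -/

/-- The seven regions fill the complement of the three curves. -/
theorem regions_cover : R1 ∪ R2 ∪ R3 ∪ R4 ∪ R5 ∪ R6 ∪ R7 =
    {z : ℝ × ℝ | z.1 ≠ 0 ∧ z.2 ≠ 0 ∧ (z.1 - 1) * (z.2 - 1) ≠ 1} := by
  ext ⟨x, y⟩
  simp only [R1, R2, R3, R4, R5, R6, R7, Set.mem_union, Set.mem_ofPred_eq]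
  constructor
  · rintro ((((((⟨h, k⟩ | ⟨h, k, l⟩) | ⟨h, k, l⟩) | ⟨h, k, l⟩) | ⟨h, k, l⟩) | ⟨h, k, l⟩) | ⟨h, k, l⟩)
    · exact ⟨h.ne, k.ne, by nlinarith [mul_pos_of_neg_of_neg h k]⟩
    · exact ⟨h.ne', k.ne', l.ne'⟩
    · exact ⟨h.ne', k.ne', l.ne⟩
    · exact ⟨h.ne', k.ne, l.ne'⟩
    · exact ⟨h.ne', k.ne, l.ne⟩
    · exact ⟨h.ne, k.ne', l.ne'⟩
    · exact ⟨h.ne, k.ne', l.ne⟩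
  · rintro ⟨h, k, l⟩
    rcases lt_or_gt_of_ne h with h | h <;> rcases lt_or_gt_of_ne k with k | k <;>
      rcases lt_or_gt_of_ne l with l | l <;> tauto

theorem continuous_incl (b : ℝ) : Continuous (incl b) := by
  refine Continuous.subtype_mk ?_ _
  unfold coords
  refine Continuous.prodMk (OnePoint.continuous_coe.comp continuous_fst)
    (Continuous.prodMk (OnePoint.continuous_coe.comp continuous_snd)
      (Continuous.prodMk (OnePoint.continuous_coe.comp (by fun_prop))
        (OnePoint.continuous_coe.comp ?_)))
  exact Continuous.div (by fun_prop) (by fun_prop) (fun z => by positivity)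

theorem denseRange_incl (b : ℝ) : DenseRange (incl b) := by
  intro p
  rw [Topology.IsInducing.subtypeVal.closure_eq_preimage_closure_image]
  have h : Subtype.val '' Set.range (incl b) = Set.range (coords b) := by
    rw [← Set.range_comp]; rfl
  rw [h]
  exact p.2

/-- The extension by continuity from a dense set has at most one value at each point. -/
theorem IsValue.unique {b : ℝ} {g : ℝ × ℝ → ℝ × ℝ} {D : Set (ℝ × ℝ)} (hD : Dense D)
    {p q q' : XR b} (h : IsValue b g D p q) (h' : IsValue b g D p q') : q = q' := by
  have hne : (comap (incl b) (𝓝 p) ⊓ 𝓟 D).NeBot := by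
    rw [inf_principal_neBot_iff]
    intro s hs
    obtain ⟨t, ht, hts⟩ := mem_comap.1 hs
    obtain ⟨o, hot, ho, hpo⟩ := mem_nhds_iff.1 ht
    obtain ⟨z, hz⟩ := (denseRange_incl b).exists_mem_open ho ⟨p, hpo⟩
    obtain ⟨w, hw, hwD⟩ := hD.inter_open_nonempty _ (ho.preimage (continuous_incl b)) ⟨z, hz⟩
    exact ⟨w, hts (hot hw), hwD⟩
  exact tendsto_nhds_unique h h'

end BirationalPlane

end

/-! The involution τ extends to a homeomorphism of the whole surface and conjugates f⁻¹ to f, so a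
point p escapes backward exactly when τp escapes forward (`backward_iff`). It is therefore enough to
show that p or τp escapes forward.

Along infinity the extension of f is explicit. V₀ and V₂ are mapped into themselves. V₄ and V₅ are
exchanged, and f² translates the parameter of V₄ by 2a + 1; V₃ is exchanged with the line x = 0, and
f² translates y on that line by a − 1. The only obstacles are the point of V₄ with parameter 1 and
the origin. Since a < −1, both translations are negative, and τ reflects the parameters so that p or
τp starts on the far side of the obstacle, where the forward orbit never meets it.

A finite point is called `Recurrent` if neither it nor its τ-image escapes forward; this property is
invariant under τ, f and f⁻¹. Recurrent points avoid the line x = 0 and the critical curves, which f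
sends into V₅ or to the point (0, a + 1), both on escaping orbits. They also avoid the regions
outside U: such a point or its τ-image lies in, or is mapped by f into, one of two traps in the
third and fourth quadrants. These traps are exchanged by f, and monotonicity of the x-coordinate
forces escape there (`cobounded_of_alternating`). So recurrent points lie in U, and by invariance in
Ω. -/

noncomputable section

namespace BirationalPlane

open Bornology

/-! ### Limits of real functions whose absolute value tends to infinity -/

section Limits

variable {α : Type*} {F : Filter α} {g h : α → ℝ} {c : ℝ}

theorem cobounded_iff_abs : Tendsto g F (cobounded ℝ) ↔ Tendsto (fun z => |g z|) F atTop :=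
  tendsto_norm_atTop_iff_cobounded.symm

theorem cobounded_add (hg : Tendsto g F (cobounded ℝ)) (hh : Tendsto h F (𝓝 c)) :
    Tendsto (fun z => g z + h z) F (cobounded ℝ) := by
  rw [cobounded_iff_abs] at hg ⊢
  refine tendsto_atTop_mono (fun z => ?_) (hg.atTop_add hh.abs.neg)
  have := abs_sub (g z + h z) (h z)
  rw [add_sub_cancel_right] at this
  linarith

theorem cobounded_neg (hg : Tendsto g F (cobounded ℝ)) :
    Tendsto (fun z => -g z) F (cobounded ℝ) := by
  rw [cobounded_iff_abs] at hg ⊢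
  simpa using hg

theorem cobounded_mul (hg : Tendsto g F (cobounded ℝ)) (hh : Tendsto h F (𝓝 c)) (hc : c ≠ 0) :
    Tendsto (fun z => g z * h z) F (cobounded ℝ) := by
  rw [cobounded_iff_abs] at hg ⊢
  simp only [abs_mul]
  exact hg.atTop_mul_pos (abs_pos.2 hc) hh.abs

/-- The limit c may be 0: a small denominator only enlarges the quotient, so a bound on |h|
suffices. -/
theorem cobounded_div (hg : Tendsto g F (cobounded ℝ)) (hh : Tendsto h F (𝓝 c))
    (hne : ∀ᶠ z in F, h z ≠ 0) : Tendsto (fun z => g z / h z) F (cobounded ℝ) := by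
  rw [cobounded_iff_abs] at hg ⊢
  have h1 : ∀ᶠ z in F, |h z| < |c| + 1 := hh.abs.eventually_lt_const (by linarith)
  have h2 : Tendsto (fun z => |g z| / (|c| + 1)) F atTop :=
    hg.atTop_div_const (by positivity)
  refine tendsto_atTop_mono' F ?_ h2
  filter_upwards [h1, hne] with z hz hz'
  rw [abs_div]
  exact div_le_div_of_nonneg_left (abs_nonneg _) (abs_pos.2 hz') hz.le

theorem cobounded_div_of_zero (hg : Tendsto g F (𝓝 c)) (hc : c ≠ 0) (hh : Tendsto h F (𝓝 0))
    (hne : ∀ᶠ z in F, h z ≠ 0) : Tendsto (fun z => g z / h z) F (cobounded ℝ) := by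
  have h1 : Tendsto (fun z => (h z)⁻¹) F (cobounded ℝ) :=
    tendsto_inv₀_nhdsNE_zero.comp (tendsto_nhdsWithin_iff.2 ⟨hh, hne⟩)
  refine (cobounded_mul h1 hg hc).congr fun z => ?_
  rw [div_eq_mul_inv, mul_comm]

theorem cobounded_ne (hg : Tendsto g F (cobounded ℝ)) (c : ℝ) : ∀ᶠ z in F, g z ≠ c := by
  rw [cobounded_iff_abs] at hg
  filter_upwards [hg.eventually_gt_atTop |c|] with z hz h
  rw [h] at hz
  exact lt_irrefl _ hz

theorem tendsto_inv_of_cobounded (hg : Tendsto g F (cobounded ℝ)) :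
    Tendsto (fun z => (g z)⁻¹) F (𝓝 0) :=
  tendsto_inv₀_cobounded.comp hg

theorem tendsto_div_of_cobounded (hg : Tendsto g F (𝓝 c)) (hh : Tendsto h F (cobounded ℝ)) :
    Tendsto (fun z => g z / h z) F (𝓝 0) := by
  simpa [div_eq_mul_inv] using hg.mul (tendsto_inv_of_cobounded hh)

/-- The factor `(x - 1) / (x² + 1)` of the fourth coordinate vanishes at infinity. -/
theorem tendsto_kernel (hg : Tendsto g F (cobounded ℝ)) :
    Tendsto (fun z => (g z - 1) / (g z ^ 2 + 1)) F (𝓝 0) := by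
  have hi := tendsto_inv_of_cobounded hg
  have : Tendsto (fun z => ((g z)⁻¹ - (g z)⁻¹ ^ 2) / (1 + (g z)⁻¹ ^ 2)) F
      (𝓝 ((0 - 0 ^ 2) / (1 + 0 ^ 2))) :=
    (hi.sub (hi.pow 2)).div (tendsto_const_nhds.add (hi.pow 2)) (by norm_num)
  rw [show ((0 : ℝ) - 0 ^ 2) / (1 + 0 ^ 2) = 0 by norm_num] at this
  refine this.congr' ?_
  filter_upwards [cobounded_ne hg 0] with z hz
  have : g z ^ 2 + 1 ≠ 0 := by positivity
  field_simp

theorem tendsto_mul_kernel (hg : Tendsto g F (cobounded ℝ)) :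
    Tendsto (fun z => g z * ((g z - 1) / (g z ^ 2 + 1))) F (𝓝 1) := by
  have hi := tendsto_inv_of_cobounded hg
  have : Tendsto (fun z => (1 - (g z)⁻¹) / (1 + (g z)⁻¹ ^ 2)) F
      (𝓝 ((1 - 0) / (1 + 0 ^ 2))) :=
    (tendsto_const_nhds.sub hi).div (tendsto_const_nhds.add (hi.pow 2)) (by norm_num)
  rw [show ((1 : ℝ) - 0) / (1 + 0 ^ 2) = 1 by norm_num] at this
  refine this.congr' ?_
  filter_upwards [cobounded_ne hg 0] with z hz
  have : g z ^ 2 + 1 ≠ 0 := by positivity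
  field_simp

theorem tendsto_coe_infty :
    Tendsto (fun z => ((g z : ℝ) : OnePoint ℝ)) F (𝓝 OnePoint.infty) ↔
      Tendsto g F (cobounded ℝ) := by
  rw [Metric.cobounded_eq_cocompact, ← coclosedCompact_eq_cocompact,
    ← OnePoint.comap_coe_nhds_infty, tendsto_comap_iff]
  rfl

theorem tendsto_coe_coe :
    Tendsto (fun z => ((g z : ℝ) : OnePoint ℝ)) F (𝓝 (c : OnePoint ℝ)) ↔ Tendsto g F (𝓝 c) :=
  (OnePoint.isOpenEmbedding_coe.isInducing.tendsto_nhds_iff (f := g)).symm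

end Limits

/-! ### The points at infinity -/

/-- The target of `coords`. -/
abbrev ProjFour : Type := OnePoint ℝ × OnePoint ℝ × OnePoint ℝ × OnePoint ℝ

/-- The point of slope `t` on the line at infinity. -/
def ptV0 (t : OnePoint ℝ) : ProjFour := (OnePoint.infty, OnePoint.infty, OnePoint.infty, t)

/-- The point of `V₂` on the line `x = t`. -/
def ptV2 (t : ℝ) : ProjFour := ((t : OnePoint ℝ), OnePoint.infty, OnePoint.infty, OnePoint.infty)

/-- The point of `V₃` on the conic `(x - 1)(y - 1) = s`. -/
def ptV3 (s : ℝ) : ProjFour :=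
  (((1 : ℝ) : OnePoint ℝ), OnePoint.infty, OnePoint.infty, ((s / 2 : ℝ) : OnePoint ℝ))

/-- The point of `V₄` on the line `y = t`. -/
def ptV4 (t : ℝ) : ProjFour :=
  (OnePoint.infty, (t : OnePoint ℝ), OnePoint.infty, ((0 : ℝ) : OnePoint ℝ))

/-- The point of `V₅` on the line `y = b x + t`. -/
def ptV5 (b t : ℝ) : ProjFour :=
  (OnePoint.infty, OnePoint.infty, (t : OnePoint ℝ), (b : OnePoint ℝ))

/-! ### Criteria for convergence to each curve at infinity -/

section Targets

variable {α : Type*} {F : Filter α} {b : ℝ} {z : α → ℝ × ℝ}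

theorem tendsto_coords_iff {p : ProjFour} : Tendsto (fun i => coords b (z i)) F (𝓝 p) ↔
    Tendsto (fun i => (((z i).1 : ℝ) : OnePoint ℝ)) F (𝓝 p.1) ∧
    Tendsto (fun i => (((z i).2 : ℝ) : OnePoint ℝ)) F (𝓝 p.2.1) ∧
    Tendsto (fun i => (((z i).2 - b * (z i).1 : ℝ) : OnePoint ℝ)) F (𝓝 p.2.2.1) ∧
    Tendsto (fun i => (((z i).2 * ((z i).1 - 1) / ((z i).1 ^ 2 + 1) : ℝ) : OnePoint ℝ)) F
      (𝓝 p.2.2.2) := by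
  obtain ⟨p1, p2, p3, p4⟩ := p
  rw [Prod.tendsto_iff, Prod.tendsto_iff, Prod.tendsto_iff]
  rfl

theorem tendsto_ptV4 {c : ℝ} (hb : b ≠ 0) (hx : Tendsto (fun i => (z i).1) F (cobounded ℝ))
    (hy : Tendsto (fun i => (z i).2) F (𝓝 c)) :
    Tendsto (fun i => coords b (z i)) F (𝓝 (ptV4 c)) := by
  rw [tendsto_coords_iff]
  refine ⟨tendsto_coe_infty.2 hx, tendsto_coe_coe.2 hy, tendsto_coe_infty.2 ?_,
    tendsto_coe_coe.2 ?_⟩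
  · refine (cobounded_add (cobounded_mul hx (tendsto_const_nhds (x := -b)) (neg_ne_zero.2 hb))
      hy).congr fun i => ?_
    ring
  · simpa [mul_div_assoc] using hy.mul (tendsto_kernel hx)

theorem tendsto_ptV5 {c : ℝ} (hb : b ≠ 0) (hx : Tendsto (fun i => (z i).1) F (cobounded ℝ))
    (hw : Tendsto (fun i => (z i).2 - b * (z i).1) F (𝓝 c)) :
    Tendsto (fun i => coords b (z i)) F (𝓝 (ptV5 b c)) := by
  rw [tendsto_coords_iff]
  refine ⟨tendsto_coe_infty.2 hx, tendsto_coe_infty.2 ?_, tendsto_coe_coe.2 hw,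
    tendsto_coe_coe.2 ?_⟩
  · refine (cobounded_add (cobounded_mul hx (tendsto_const_nhds (x := b)) hb)
      hw).congr fun i => ?_
    ring
  · have := ((tendsto_mul_kernel hx).const_mul b).add (hw.mul (tendsto_kernel hx))
    simp only [mul_one, mul_zero, add_zero] at this
    refine this.congr fun i => ?_
    ring

theorem cobounded_third {c : ℝ} (hx : Tendsto (fun i => (z i).1) F (𝓝 c))
    (hy : Tendsto (fun i => (z i).2) F (cobounded ℝ)) :
    Tendsto (fun i => (z i).2 - b * (z i).1) F (cobounded ℝ) := by
  simpa [sub_eq_add_neg] using cobounded_add hy (hx.const_mul b).neg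

theorem tendsto_ptV2 {c : ℝ} (hx : Tendsto (fun i => (z i).1) F (𝓝 c))
    (hy : Tendsto (fun i => (z i).2) F (cobounded ℝ))
    (hs : Tendsto (fun i => (z i).2 * ((z i).1 - 1)) F (cobounded ℝ)) :
    Tendsto (fun i => coords b (z i)) F (𝓝 (ptV2 c)) := by
  rw [tendsto_coords_iff]
  refine ⟨tendsto_coe_coe.2 hx, tendsto_coe_infty.2 hy, tendsto_coe_infty.2 (cobounded_third hx hy),
    tendsto_coe_infty.2 ?_⟩
  exact cobounded_div hs ((hx.pow 2).add_const 1) (Eventually.of_forall fun i => by positivity)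

theorem tendsto_ptV3 {c : ℝ} (hx : Tendsto (fun i => (z i).1) F (𝓝 1))
    (hy : Tendsto (fun i => (z i).2) F (cobounded ℝ))
    (hs : Tendsto (fun i => (z i).2 * ((z i).1 - 1)) F (𝓝 c)) :
    Tendsto (fun i => coords b (z i)) F (𝓝 (ptV3 c)) := by
  rw [tendsto_coords_iff]
  refine ⟨tendsto_coe_coe.2 hx, tendsto_coe_infty.2 hy, tendsto_coe_infty.2 (cobounded_third hx hy),
    tendsto_coe_coe.2 ?_⟩
  have := hs.div ((hx.pow 2).add_const 1) (by norm_num)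
  norm_num at this
  exact this

/-- A point of the surface is the limit of the finite points near it. -/
theorem tendsto_coords_self (p : XR b) : Tendsto (coords b) (comap (incl b) (𝓝 p)) (𝓝 p.1) :=
  (continuous_subtype_val.tendsto p).comp tendsto_comap

theorem neBot_comap_incl {D : Set (ℝ × ℝ)} (hD : Dense D) (p : XR b) :
    (comap (incl b) (𝓝 p) ⊓ 𝓟 D).NeBot := by
  rw [inf_principal_neBot_iff]
  intro s hs
  obtain ⟨t, ht, hts⟩ := mem_comap.1 hs
  obtain ⟨o, hot, ho, hpo⟩ := mem_nhds_iff.1 ht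
  obtain ⟨z, hz⟩ := (denseRange_incl b).exists_mem_open ho ⟨p, hpo⟩
  obtain ⟨w, hw, hwD⟩ := hD.inter_open_nonempty _ (ho.preimage (continuous_incl b)) ⟨z, hz⟩
  exact ⟨w, hts (hot hw), hwD⟩

/-- The points of the surface: the plane and the five curves at infinity. -/
theorem point_cases (hb : b ≠ 0) (p : XR b) : (∃ z, p = incl b z) ∨ (∃ t, p.1 = ptV0 t) ∨
    (∃ t, p.1 = ptV2 t) ∨ (∃ t, p.1 = ptV3 t) ∨ (∃ t, p.1 = ptV4 t) ∨ (∃ t, p.1 = ptV5 b t) := by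
  have hF : (comap (incl b) (𝓝 p)).NeBot := by
    simpa using neBot_comap_incl dense_univ p
  have h := tendsto_coords_self p
  obtain ⟨p, hp⟩ := p
  simp only at h ⊢
  generalize comap (incl b) _ = F at h hF
  have h' := h
  rw [show coords b = fun i => coords b (id i) from rfl, tendsto_coords_iff] at h
  obtain ⟨p1, p2, p3, p4⟩ := p
  obtain ⟨h1, h2, h3, h4⟩ := h
  simp only [id] at h1 h2 h3 h4
  -- By uniqueness of limits, the few coordinates that decide which curve p lies on determine the
  -- others.
  have key : ∀ q : ProjFour, Tendsto (coords b) F (𝓝 q) →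
      ((p1, p2, p3, p4) : ProjFour) = q := fun q hq => tendsto_nhds_unique h' hq
  induction p1 using OnePoint.rec with
  | infty =>
    rw [tendsto_coe_infty] at h1
    induction p2 using OnePoint.rec with
    | infty =>
      induction p3 using OnePoint.rec with
      | infty => exact Or.inr (Or.inl ⟨p4, rfl⟩)
      | coe t =>
        rw [tendsto_coe_coe] at h3
        exact Or.inr (Or.inr (Or.inr (Or.inr (Or.inr ⟨t, key _ (tendsto_ptV5 hb h1 h3)⟩))))
    | coe t =>
      rw [tendsto_coe_coe] at h2
      exact Or.inr (Or.inr (Or.inr (Or.inr (Or.inl ⟨t, key _ (tendsto_ptV4 hb h1 h2)⟩))))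
  | coe x =>
    rw [tendsto_coe_coe] at h1
    induction p2 using OnePoint.rec with
    | infty =>
      rw [tendsto_coe_infty] at h2
      induction p4 using OnePoint.rec with
      | infty =>
        rw [tendsto_coe_infty] at h4
        refine Or.inr (Or.inr (Or.inl ⟨x, key _ (tendsto_ptV2 h1 h2 ?_)⟩))
        refine (cobounded_mul h4 ((h1.pow 2).add_const 1) (by positivity)).congr fun z => ?_
        have : z.1 ^ 2 + 1 ≠ 0 := by positivity
        field_simp
      | coe s =>
        rw [tendsto_coe_coe] at h4
        have hs : Tendsto (fun z : ℝ × ℝ => z.2 * (z.1 - 1)) F (𝓝 (s * (x ^ 2 + 1))) := by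
          refine (h4.mul ((h1.pow 2).add_const 1)).congr fun z => ?_
          have : z.1 ^ 2 + 1 ≠ 0 := by positivity
          field_simp
        -- For x ≠ 1 the product y (x − 1) would be unbounded, against the finite fourth coordinate.
        have hx : x = 1 := by
          by_contra hx
          have := cobounded_mul h2 (h1.sub_const 1) (sub_ne_zero.2 hx)
          exact not_tendsto_nhds_of_tendsto_atTop (cobounded_iff_abs.1 this) _ hs.abs
        subst hx
        exact Or.inr (Or.inr (Or.inr (Or.inl ⟨_, key _ (tendsto_ptV3 h1 h2 hs)⟩)))
    | coe y =>
      rw [tendsto_coe_coe] at h2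
      refine Or.inl ⟨(x, y), Subtype.ext (key _ ?_)⟩
      have hc : Continuous (coords b) := continuous_subtype_val.comp (continuous_incl b)
      exact (hc.tendsto (x, y)).comp (h1.prodMk_nhds h2)

end Targets

/-! ### Finite points and infinity -/

/-- The first two coordinates already recover the topology of the plane. -/
theorem isInducing_incl (b : ℝ) : IsInducing (incl b) := by
  have hproj : Continuous fun p : XR b => (p.1.1, p.1.2.1) := by fun_prop
  refine IsInducing.of_comp (continuous_incl b) hproj ?_
  exact (OnePoint.isOpenEmbedding_coe.isInducing).prodMap OnePoint.isOpenEmbedding_coe.isInducing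

theorem compactSpace_XR (b : ℝ) : CompactSpace (XR b) :=
  isCompact_iff_compactSpace.1 isClosed_closure.isCompact

/-- The complement of an open neighbourhood of infinity is compact and lies inside the plane, so a
sequence leaving all compact sets leaves it. -/
theorem tendsto_infinity_of_cobounded {b : ℝ} {z : ℕ → ℝ × ℝ}
    (hz : Tendsto z atTop (cobounded (ℝ × ℝ))) :
    Tendsto (fun n => incl b (z n)) atTop (𝓝ˢ (infinity b)) := by
  have := compactSpace_XR b
  intro s hs
  rw [mem_nhdsSet_iff_exists] at hs
  obtain ⟨u, hu, hiu, hus⟩ := hs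
  have hK : IsCompact (incl b ⁻¹' uᶜ) := by
    refine (isInducing_incl b).isCompact_preimage_iff ?_ |>.2 hu.isClosed_compl.isCompact
    exact Set.compl_subset_comm.1 hiu
  rw [Metric.cobounded_eq_cocompact] at hz
  change ∀ᶠ n in atTop, incl b (z n) ∈ s
  filter_upwards [hz.eventually hK.compl_mem_cocompact] with n hn
  have : ¬ ¬ incl b (z n) ∈ u := hn
  exact hus (not_not.1 this)

theorem notMem_infinity_iff {b : ℝ} {p : XR b} : p ∉ infinity b ↔ ∃ z, incl b z = p := by
  simp [infinity]

theorem mem_infinity_of_coord {b : ℝ} {p : XR b}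
    (h : p.1.1 = OnePoint.infty ∨ p.1.2.1 = OnePoint.infty) : p ∈ infinity b := by
  by_contra hp
  obtain ⟨z, rfl⟩ := notMem_infinity_iff.1 hp
  rcases h with h | h
  · exact OnePoint.coe_ne_infty _ h
  · exact OnePoint.coe_ne_infty _ h

/-! ### The extension of the involution `τ` -/

/-- The map `v ↦ u - v` of the projective line. -/
def reflect (u : ℝ) : OnePoint ℝ → OnePoint ℝ := OnePoint.map (fun v => u - v)

@[simp] theorem reflect_coe (u v : ℝ) : reflect u (v : OnePoint ℝ) = ((u - v : ℝ) : OnePoint ℝ) :=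
  rfl

@[simp] theorem reflect_infty (u : ℝ) : reflect u OnePoint.infty = OnePoint.infty := rfl

/-- Joint continuity is needed because in the fourth coordinate of `tauProj` the sum u varies with
the first coordinate; it holds at v = ∞ because u stays finite. -/
theorem continuous_reflect : Continuous fun q : ℝ × OnePoint ℝ => reflect q.1 q.2 := by
  rw [continuous_iff_continuousAt]
  rintro ⟨u, v⟩
  induction v using OnePoint.rec with
  | infty =>
    unfold ContinuousAt
    rw [nhds_prod_eq, OnePoint.nhds_infty_eq, prod_sup, tendsto_sup]
    simp only [reflect_infty]
    constructor
    · have h : Tendsto (fun q : ℝ × ℝ => q.1 - q.2) (𝓝 u ×ˢ cobounded ℝ) (cobounded ℝ) := by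
        refine (cobounded_add (cobounded_neg tendsto_snd) tendsto_fst).congr fun q => ?_
        ring
      rw [← map_id (f := 𝓝 u), prod_map_map_eq, tendsto_map'_iff, coclosedCompact_eq_cocompact,
        ← Metric.cobounded_eq_cocompact]
      exact tendsto_coe_infty.2 h
    · rw [prod_pure, tendsto_map'_iff]
      exact tendsto_const_nhds
  | coe v =>
    have h : IsOpenEmbedding (Prod.map (id : ℝ → ℝ) ((↑) : ℝ → OnePoint ℝ)) :=
      IsOpenEmbedding.id.prodMap OnePoint.isOpenEmbedding_coe
    refine (h.continuousAt_iff (x := (u, v))).1 ?_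
    have : Continuous fun q : ℝ × ℝ => ((q.1 - q.2 : ℝ) : OnePoint ℝ) :=
      OnePoint.continuous_coe.comp (by fun_prop)
    exact this.continuousAt

/-- The sum of the fourth coordinates of `z` and `τ z`, as a function on the projective line. -/
def slopeSum (a b : ℝ) : OnePoint ℝ → ℝ :=
  fun x => x.elim b fun x => (b * x + a + 1) * (x - 1) / (x ^ 2 + 1)

@[simp] theorem slopeSum_coe (a b x : ℝ) :
    slopeSum a b (x : OnePoint ℝ) = (b * x + a + 1) * (x - 1) / (x ^ 2 + 1) := rfl

@[simp] theorem slopeSum_infty (a b : ℝ) : slopeSum a b OnePoint.infty = b := rfl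

theorem continuous_slopeSum (a b : ℝ) : Continuous (slopeSum a b) := by
  rw [continuous_iff_continuousAt]
  intro x
  induction x using OnePoint.rec with
  | infty =>
    unfold ContinuousAt
    rw [OnePoint.nhds_infty_eq, tendsto_sup, tendsto_map'_iff, coclosedCompact_eq_cocompact,
      ← Metric.cobounded_eq_cocompact]
    refine ⟨?_, tendsto_pure_nhds _ _⟩
    have := ((tendsto_mul_kernel (tendsto_id (x := cobounded ℝ))).const_mul b).add
      ((tendsto_kernel (tendsto_id (x := cobounded ℝ))).const_mul (a + 1))
    simp only [mul_one, mul_zero, add_zero, id] at this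
    refine this.congr fun x => ?_
    simp only [Function.comp, slopeSum_coe]
    ring
  | coe x =>
    rw [OnePoint.continuousAt_coe]
    have : Continuous fun x : ℝ => (b * x + a + 1) * (x - 1) / (x ^ 2 + 1) :=
      Continuous.div (by fun_prop) (by fun_prop) fun x => by positivity
    exact this.continuousAt

/-- The extension of `τ` to the ambient space of the surface. -/
def tauProj (a b : ℝ) (p : ProjFour) : ProjFour :=
  (p.1, reflect (a + 1) p.2.2.1, reflect (a + 1) p.2.1, reflect (slopeSum a b p.1) p.2.2.2)

theorem continuous_tauProj (a b : ℝ) : Continuous (tauProj a b) := by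
  have h := continuous_reflect
  have hr := continuous_slopeSum a b
  unfold tauProj
  refine continuous_fst.prodMk (Continuous.prodMk ?_ (Continuous.prodMk ?_ ?_))
  · exact h.comp (continuous_const.prodMk (by fun_prop))
  · exact h.comp (continuous_const.prodMk (by fun_prop))
  · exact h.comp ((hr.comp continuous_fst).prodMk (by fun_prop))

theorem tauProj_coords (a b : ℝ) (z : ℝ × ℝ) :
    tauProj a b (coords b z) = coords b (tau a b z) := by
  obtain ⟨x, y⟩ := z
  simp only [tauProj, coords, tau, reflect_coe, slopeSum_coe]
  refine Prod.ext rfl (Prod.ext (congrArg _ ?_) (Prod.ext (congrArg _ ?_) (congrArg _ ?_))) <;> ring_nf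

theorem tauProj_mem (a b : ℝ) (p : XR b) : tauProj a b p.1 ∈ closure (Set.range (coords b)) := by
  refine map_mem_closure (continuous_tauProj a b) p.2 ?_
  rintro _ ⟨z, rfl⟩
  exact ⟨_, (tauProj_coords a b z).symm⟩

/-- The extension of `τ` to the surface. -/
def tauX (a b : ℝ) (p : XR b) : XR b := ⟨tauProj a b p.1, tauProj_mem a b p⟩

theorem continuous_tauX (a b : ℝ) : Continuous (tauX a b) :=
  ((continuous_tauProj a b).comp continuous_subtype_val).subtype_mk _

@[simp] theorem tauX_incl (a b : ℝ) (z : ℝ × ℝ) : tauX a b (incl b z) = incl b (tau a b z) :=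
  Subtype.ext (tauProj_coords a b z)

@[simp] theorem tau_tau (a b : ℝ) (z : ℝ × ℝ) : tau a b (tau a b z) = z := by
  simp [tau]

@[simp] theorem tauX_tauX (a b : ℝ) (p : XR b) : tauX a b (tauX a b p) = p := by
  have : tauX a b ∘ tauX a b = id := by
    refine (denseRange_incl b).equalizer ((continuous_tauX a b).comp (continuous_tauX a b))
      continuous_id ?_
    ext1 z
    simp
  exact congrFun this p

theorem tauX_mem_infinity {a b : ℝ} {p : XR b} (hp : p ∈ infinity b) :
    tauX a b p ∈ infinity b := by
  by_contra h
  obtain ⟨z, hz⟩ := notMem_infinity_iff.1 h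
  refine hp ⟨tau a b z, ?_⟩
  rw [← tauX_incl, hz, tauX_tauX]

theorem tauProj_ptV3 (a b s : ℝ) : tauProj a b (ptV3 s) = ptV3 (-s) := by
  simp [tauProj, ptV3, neg_div]

theorem tauProj_ptV4 (a b t : ℝ) : tauProj a b (ptV4 t) = ptV5 b (a + 1 - t) := by
  simp [tauProj, ptV4, ptV5]

theorem tauProj_ptV5 (a b t : ℝ) : tauProj a b (ptV5 b t) = ptV4 (a + 1 - t) := by
  simp [tauProj, ptV4, ptV5]

/-! ### Values of the maps -/

theorem dense_sigmaDom : Dense sigmaDom :=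
  (dense_compl_singleton (0 : ℝ)).prod (dense_compl_singleton (0 : ℝ))

theorem exists_isValue {b : ℝ} {g : ℝ × ℝ → ℝ × ℝ} {D : Set (ℝ × ℝ)} (hD : Dense D) {p : XR b}
    {q : ProjFour}
    (h : Tendsto (fun z => coords b (g z)) (comap (incl b) (𝓝 p) ⊓ 𝓟 D) (𝓝 q)) :
    ∃ r : XR b, r.1 = q ∧ IsValue b g D p r := by
  have := neBot_comap_incl hD p
  have hq : q ∈ closure (Set.range (coords b)) :=
    isClosed_closure.mem_of_tendsto h
      (Eventually.of_forall fun z => subset_closure (Set.mem_range_self _))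
  exact ⟨⟨q, hq⟩, rfl, tendsto_subtype_rng.2 h⟩

theorem fMaps_of_sigma {a b : ℝ} {p q : XR b} (h : IsValue b sigma sigmaDom p q) :
    FMaps a b p (tauX a b q) := by
  have := ((continuous_tauX a b).tendsto q).comp h
  refine this.congr fun z => ?_
  simp

theorem tendsto_tau_comap {a b : ℝ} {p : XR b} {D : Set (ℝ × ℝ)} :
    Tendsto (tau a b) (comap (incl b) (𝓝 p) ⊓ 𝓟 (tau a b ⁻¹' D))
      (comap (incl b) (𝓝 (tauX a b p)) ⊓ 𝓟 D) := by
  refine tendsto_inf.2 ⟨tendsto_comap_iff.2 ?_, tendsto_principal.2 ?_⟩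
  · have := ((continuous_tauX a b).tendsto p).comp (tendsto_comap (f := incl b))
    refine (this.mono_left inf_le_left).congr fun z => ?_
    simp
  · exact mem_inf_of_right (mem_principal_self _)

/-- Reversibility: τ ∘ (σ ∘ τ) ∘ τ = τ ∘ σ, and τ is continuous on the whole surface, so it also
matches the points of indeterminacy. -/
theorem fInvMaps_iff {a b : ℝ} {p q : XR b} :
    FInvMaps a b p q ↔ FMaps a b (tauX a b p) (tauX a b q) := by
  constructor
  · intro h
    have ht := tendsto_tau_comap (a := a) (p := tauX a b p) (D := tau a b ⁻¹' sigmaDom)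
    rw [tauX_tauX, ← Set.preimage_comp, show tau a b ∘ tau a b = id from
      funext fun z => tau_tau a b z, Set.preimage_id] at ht
    refine (((continuous_tauX a b).tendsto q).comp (h.comp ht)).congr fun z => ?_
    simp
  · intro h
    have := ((continuous_tauX a b).tendsto _).comp (h.comp (tendsto_tau_comap (a := a) (p := p)))
    rw [tauX_tauX] at this
    refine this.congr fun z => ?_
    simp

theorem backward_iff {a b : ℝ} {p : XR b} :
    BackwardToInfinity a b p ↔ ForwardToInfinity a b (tauX a b p) := by
  have hT : Tendsto (tauX a b) (𝓝ˢ (infinity b)) (𝓝ˢ (infinity b)) :=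
    (continuous_tauX a b).tendsto_nhdsSet fun p hp => tauX_mem_infinity hp
  constructor
  · rintro ⟨u, h0, h1, h2⟩
    exact ⟨fun n => tauX a b (u n), by simp [h0], fun n => fInvMaps_iff.1 (h1 n), hT.comp h2⟩
  · rintro ⟨u, h0, h1, h2⟩
    refine ⟨fun n => tauX a b (u n), by simp [h0], fun n => fInvMaps_iff.2 ?_, hT.comp h2⟩
    simpa using h1 n

theorem forward_iff_of_fMaps {a b : ℝ} {p q : XR b} (h : FMaps a b p q) :
    ForwardToInfinity a b p ↔ ForwardToInfinity a b q := by
  constructor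
  · rintro ⟨u, h0, h1, h2⟩
    refine ⟨fun n => u (n + 1), ?_, fun n => h1 (n + 1), h2.comp (tendsto_add_atTop_nat 1)⟩
    exact IsValue.unique dense_sigmaDom (h0 ▸ h1 0) h
  · rintro ⟨u, h0, h1, h2⟩
    refine ⟨fun n => Nat.rec p (fun k _ => u k) n, rfl, fun n => ?_, ?_⟩
    · cases n with
      | zero => simpa [h0] using h
      | succ n => exact h1 n
    · exact (tendsto_add_atTop_iff_nat 1).1 h2

/-- An orbit that never leaves infinity tends to it trivially; only the absence of indeterminacy
matters. -/
theorem forward_of_invariant {a b : ℝ} {S : Set (XR b)} (hS : S ⊆ infinity b)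
    (hf : ∀ p ∈ S, ∃ q ∈ S, FMaps a b p q) {p : XR b} (hp : p ∈ S) : ForwardToInfinity a b p := by
  choose! φ hφ hφ' using hf
  have hmem : ∀ n, φ^[n] p ∈ S := fun n => by
    induction n with
    | zero => exact hp
    | succ n ih => rw [Function.iterate_succ_apply']; exact hφ _ ih
  refine ⟨fun n => φ^[n] p, rfl, fun n => ?_, ?_⟩
  · simp only [Function.iterate_succ_apply']
    exact hφ' _ (hmem n)
  · refine Tendsto.mono_right ?_ (principal_le_nhdsSet)
    exact tendsto_principal.2 (Eventually.of_forall fun n => hS (hmem n))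

theorem forward_of_alternating {a b : ℝ} {v w : ℕ → XR b} (hvw : ∀ n, FMaps a b (v n) (w n))
    (hwv : ∀ n, FMaps a b (w n) (v (n + 1))) (hv : Tendsto v atTop (𝓝ˢ (infinity b)))
    (hw : Tendsto w atTop (𝓝ˢ (infinity b))) : ForwardToInfinity a b (v 0) := by
  refine ⟨fun n => if n % 2 = 0 then v (n / 2) else w (n / 2), rfl, fun n => ?_, ?_⟩
  · rcases Nat.mod_two_eq_zero_or_one n with h | h
    · have h1 : (n + 1) % 2 = 1 := by omega
      have h2 : (n + 1) / 2 = n / 2 := by omega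
      simpa [h, h1, h2] using hvw (n / 2)
    · have h1 : (n + 1) % 2 = 0 := by omega
      have h2 : (n + 1) / 2 = n / 2 + 1 := by omega
      simpa [h, h1, h2] using hwv (n / 2)
  · have hd : Tendsto (fun n : ℕ => n / 2) atTop atTop := Nat.tendsto_div_const_atTop two_ne_zero
    exact (hv.comp hd).if' (hw.comp hd)

/-! ### The extension of the involution `σ` -/

section SigmaLimits

variable {b : ℝ} {F : Filter (ℝ × ℝ)}

theorem coords_limits {p : ProjFour} (h : Tendsto (coords b) F (𝓝 p)) :
    Tendsto (fun z : ℝ × ℝ => ((z.1 : ℝ) : OnePoint ℝ)) F (𝓝 p.1) ∧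
    Tendsto (fun z : ℝ × ℝ => ((z.2 : ℝ) : OnePoint ℝ)) F (𝓝 p.2.1) ∧
    Tendsto (fun z : ℝ × ℝ => ((z.2 - b * z.1 : ℝ) : OnePoint ℝ)) F (𝓝 p.2.2.1) ∧
    Tendsto (fun z : ℝ × ℝ => ((z.2 * (z.1 - 1) / (z.1 ^ 2 + 1) : ℝ) : OnePoint ℝ)) F
      (𝓝 p.2.2.2) :=
  tendsto_coords_iff (z := id).1 h

/-- On the line at infinity the fourth coordinate is the slope. -/
theorem slope_limits {x y : ℝ × ℝ → ℝ} (hx : Tendsto x F (cobounded ℝ)) {t : OnePoint ℝ} :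
    Tendsto (fun z => ((y z * (x z - 1) / (x z ^ 2 + 1) : ℝ) : OnePoint ℝ)) F (𝓝 t) ↔
      Tendsto (fun z => ((y z / x z : ℝ) : OnePoint ℝ)) F (𝓝 t) := by
  have hk := tendsto_mul_kernel hx
  have h0 := cobounded_ne hx 0
  have hk0 : ∀ᶠ z in F, x z * ((x z - 1) / (x z ^ 2 + 1)) ≠ 0 :=
    hk.eventually_ne one_ne_zero
  have e1 : ∀ᶠ z in F, y z / x z * (x z * ((x z - 1) / (x z ^ 2 + 1))) =
      y z * (x z - 1) / (x z ^ 2 + 1) := by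
    filter_upwards [h0] with z hz
    field_simp
  have e2 : ∀ᶠ z in F, y z * (x z - 1) / (x z ^ 2 + 1) /
      (x z * ((x z - 1) / (x z ^ 2 + 1))) = y z / x z := by
    filter_upwards [e1, hk0] with z hz hz'
    rw [← hz, mul_div_cancel_right₀ _ hz']
  induction t using OnePoint.rec with
  | infty =>
    simp only [tendsto_coe_infty]
    exact ⟨fun h => (cobounded_div h hk hk0).congr' e2,
      fun h => (cobounded_mul h hk one_ne_zero).congr' e1⟩
  | coe t =>
    simp only [tendsto_coe_coe]
    exact ⟨fun h => by simpa using (h.div hk one_ne_zero).congr' e2,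
      fun h => by simpa using (h.mul hk).congr' e1⟩

theorem sigma_fst_eq {z : ℝ × ℝ} (hz : z ∈ sigmaDom) : -(z.1 * (1 - z.2⁻¹)) + 1 = (sigma z).1 := by
  have := hz.2
  simp only [sigma]
  field_simp
  ring

theorem sigma_snd_eq {z : ℝ × ℝ} (hz : z ∈ sigmaDom) : -(z.2 * (1 - z.1⁻¹)) + 1 = (sigma z).2 := by
  have := hz.1
  simp only [sigma]
  field_simp
  ring

theorem sigma_ratio {z : ℝ × ℝ} (hz : z ∈ sigmaDom) (h : (sigma z).1 ≠ 0) :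
    (sigma z).2 / (sigma z).1 = z.2 / z.1 := by
  obtain ⟨h1, h2⟩ := hz
  rw [div_eq_div_iff h h1]
  simp only [sigma]
  field_simp
  ring

/-- σ preserves the ratio y / x exactly, and near V₀ it multiplies each coordinate by a factor
tending to −1, up to a constant. -/
theorem sigma_limit_V0 (hb : b ≠ 0) (hD : ∀ᶠ z in F, z ∈ sigmaDom) {t : OnePoint ℝ}
    (h : Tendsto (coords b) F (𝓝 (ptV0 t))) :
    Tendsto (fun z => coords b (sigma z)) F (𝓝 (ptV0 t)) := by
  obtain ⟨hx, hy, -, hs⟩ := coords_limits h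
  simp only [ptV0] at hx hy hs
  rw [tendsto_coe_infty] at hx hy
  rw [slope_limits hx] at hs
  have hX : Tendsto (fun z => (sigma z).1) F (cobounded ℝ) := by
    have h1 : Tendsto (fun z : ℝ × ℝ => 1 - z.2⁻¹) F (𝓝 (1 - 0)) :=
      tendsto_const_nhds.sub (tendsto_inv_of_cobounded hy)
    exact (cobounded_add (cobounded_neg (cobounded_mul hx h1 (by norm_num)))
      (tendsto_const_nhds (x := 1))).congr' (hD.mono fun z hz => sigma_fst_eq hz)
  have hY : Tendsto (fun z => (sigma z).2) F (cobounded ℝ) := by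
    have h1 : Tendsto (fun z : ℝ × ℝ => 1 - z.1⁻¹) F (𝓝 (1 - 0)) :=
      tendsto_const_nhds.sub (tendsto_inv_of_cobounded hx)
    exact (cobounded_add (cobounded_neg (cobounded_mul hy h1 (by norm_num)))
      (tendsto_const_nhds (x := 1))).congr' (hD.mono fun z hz => sigma_snd_eq hz)
  have hX0 := cobounded_ne hX 0
  have hr : ∀ᶠ z in F, z.2 / z.1 = (sigma z).2 / (sigma z).1 := by
    filter_upwards [hD, hX0] with z hz h0 using (sigma_ratio hz h0).symm
  have hS : Tendsto (fun z => (((sigma z).2 / (sigma z).1 : ℝ) : OnePoint ℝ)) F (𝓝 t) :=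
    hs.congr' (hr.mono fun z hz => by rw [hz])
  rw [tendsto_coords_iff]
  refine ⟨tendsto_coe_infty.2 hX, tendsto_coe_infty.2 hY, tendsto_coe_infty.2 ?_,
    (slope_limits hX).2 hS⟩
  have hW : ∀ᶠ z in F, (sigma z).1 * ((sigma z).2 / (sigma z).1 + -b) =
      (sigma z).2 - b * (sigma z).1 := by
    filter_upwards [hX0] with z h0
    field_simp
    ring
  induction t using OnePoint.rec with
  | infty =>
    rw [tendsto_coe_infty] at hS
    have h1 := cobounded_add hS (tendsto_const_nhds (x := -b))
    have h2 : Tendsto (fun z => ((sigma z).2 / (sigma z).1 + -b) / (sigma z).1⁻¹) F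
        (cobounded ℝ) :=
      cobounded_div h1 (tendsto_inv_of_cobounded hX) (hX0.mono fun z h0 => inv_ne_zero h0)
    refine (h2.congr fun z => ?_).congr' hW
    rw [div_inv_eq_mul, mul_comm]
  | coe t =>
    rw [tendsto_coe_coe] at hS hs
    by_cases ht : t = b
    -- At slope b the ratio no longer decides whether y − b x is unbounded; instead σ negates y − b
    -- x up to a convergent term.
    · subst ht
      obtain ⟨-, -, hw, -⟩ := coords_limits h
      simp only [ptV0] at hw
      rw [tendsto_coe_infty] at hw
      have h1 : Tendsto (fun z : ℝ × ℝ => 1 - t + z.2 / z.1 - t * (z.2 / z.1)⁻¹) F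
          (𝓝 (1 - t + t - t * t⁻¹)) :=
        (hs.const_add _).sub ((hs.inv₀ hb).const_mul t)
      refine (cobounded_add (cobounded_neg hw) h1).congr fun z => ?_
      simp only [sigma, inv_div]
      ring
    · exact (cobounded_mul hX (hS.add_const (-b))
        (by rw [← sub_eq_add_neg]; exact sub_ne_zero.2 ht)).congr' hW

theorem sigma_snd_mul (z : ℝ × ℝ) (hz : z ∈ sigmaDom) :
    z.2 * (z.1 - 1) + (-(z.1 - 1) + ((sigma z).1 - 1)) = (sigma z).2 * ((sigma z).1 - 1) := by
  obtain ⟨h1, h2⟩ := hz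
  simp only [sigma]
  field_simp
  ring

theorem sigma_snd_div (z : ℝ × ℝ) (hz : z ∈ sigmaDom) :
    -(z.2 * (z.1 - 1) / z.1) + 1 = (sigma z).2 := by
  obtain ⟨h1, h2⟩ := hz
  simp only [sigma]
  field_simp
  ring

theorem sigma_limit_V2 (hD : ∀ᶠ z in F, z ∈ sigmaDom) {t : ℝ}
    (h : Tendsto (coords b) F (𝓝 (ptV2 t))) :
    Tendsto (fun z => coords b (sigma z)) F (𝓝 (ptV2 (1 - t))) := by
  obtain ⟨hx, hy, -, hs⟩ := coords_limits h
  simp only [ptV2] at hx hy hs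
  rw [tendsto_coe_infty] at hy hs
  rw [tendsto_coe_coe] at hx
  have hu : Tendsto (fun z : ℝ × ℝ => z.2 * (z.1 - 1)) F (cobounded ℝ) := by
    refine (cobounded_mul hs ((hx.pow 2).add_const 1) (by positivity)).congr fun z => ?_
    have : z.1 ^ 2 + 1 ≠ 0 := by positivity
    field_simp
  have hX : Tendsto (fun z => (sigma z).1) F (𝓝 (1 - t)) := by
    simpa [sigma] using (hx.const_sub 1).add (tendsto_div_of_cobounded hx hy)
  refine tendsto_ptV2 hX ?_ ?_
  · have h1 := cobounded_div hu hx (hD.mono fun z hz => hz.1)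
    exact (cobounded_add (cobounded_neg h1) (tendsto_const_nhds (x := 1))).congr'
      (hD.mono sigma_snd_div)
  · exact (cobounded_add hu ((hx.sub_const 1).neg.add (hX.sub_const 1))).congr'
      (hD.mono sigma_snd_mul)

/-- σ preserves the conic (x − 1)(y − 1) = s, which meets V₃ at parameter s and the line x = 0 at y
= 1 − s; these two points are exchanged. -/
theorem sigma_limit_V3 (hD : ∀ᶠ z in F, z ∈ sigmaDom) {s : ℝ}
    (h : Tendsto (coords b) F (𝓝 (ptV3 s))) :
    Tendsto (fun z => coords b (sigma z)) F (𝓝 (incl b (0, 1 - s)).1) := by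
  obtain ⟨hx, hy, -, hs⟩ := coords_limits h
  simp only [ptV3] at hx hy hs
  rw [tendsto_coe_infty] at hy
  rw [tendsto_coe_coe] at hx hs
  have hu : Tendsto (fun z : ℝ × ℝ => z.2 * (z.1 - 1)) F (𝓝 s) := by
    have h1 := hs.mul ((hx.pow 2).add_const 1)
    rw [show s / 2 * (1 ^ 2 + 1) = s by ring] at h1
    refine h1.congr fun z => ?_
    have : z.1 ^ 2 + 1 ≠ 0 := by positivity
    field_simp
  have hX : Tendsto (fun z => (sigma z).1) F (𝓝 0) := by
    simpa [sigma] using (hx.const_sub 1).add (tendsto_div_of_cobounded hx hy)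
  have hY : Tendsto (fun z => (sigma z).2) F (𝓝 (1 - s)) := by
    have h1 := ((hu.div hx one_ne_zero).neg.add_const 1).congr' (hD.mono sigma_snd_div)
    rwa [show -(s / 1) + 1 = 1 - s by ring] at h1
  have hc : Continuous (coords b) := continuous_subtype_val.comp (continuous_incl b)
  exact (hc.tendsto (0, 1 - s)).comp (hX.prodMk_nhds hY)

theorem sigma_limit_V4 (hb : b ≠ 0) (hD : ∀ᶠ z in F, z ∈ sigmaDom) {t : ℝ} (ht : t ≠ 1)
    (h : Tendsto (coords b) F (𝓝 (ptV4 t))) :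
    Tendsto (fun z => coords b (sigma z)) F (𝓝 (ptV4 (1 - t))) := by
  obtain ⟨hx, hy, -, -⟩ := coords_limits h
  simp only [ptV4] at hx hy
  rw [tendsto_coe_infty] at hx
  rw [tendsto_coe_coe] at hy
  refine tendsto_ptV4 hb ?_ ?_
  · have h1 := cobounded_mul hx (hy.const_sub 1) (sub_ne_zero.2 ht.symm)
    -- The first coordinate of σ is 1 + x (1 − y) / y. The case t = 0 is harmless, but t = 1 would
    -- give a product ∞ · 0.
    have h2 := cobounded_div h1 hy (hD.mono fun z hz => hz.2)
    refine (cobounded_add h2 (tendsto_const_nhds (x := 1))).congr' (hD.mono fun z hz => ?_)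
    have := hz.2
    simp only [sigma]
    field_simp
    ring
  · simpa [sigma] using (hy.const_sub 1).add (tendsto_div_of_cobounded hy hx)

theorem sigma_limit_V5 (hb : b ≠ 0) {t : ℝ}
    (h : Tendsto (coords b) F (𝓝 (ptV5 b t))) :
    Tendsto (fun z => coords b (sigma z)) F (𝓝 (ptV5 b (-t))) := by
  obtain ⟨hx, -, hw, hs⟩ := coords_limits h
  simp only [ptV5] at hx hw hs
  rw [tendsto_coe_infty] at hx
  rw [slope_limits hx, tendsto_coe_coe] at hs
  rw [tendsto_coe_coe] at hw
  have hi := hs.inv₀ hb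
  refine tendsto_ptV5 hb ?_ ?_
  · refine (cobounded_add (cobounded_neg hx) (hi.const_add 1)).congr fun z => ?_
    simp only [sigma, inv_div]
    ring
  · have h1 := (hw.neg.add (hs.const_add (1 - b))).sub (hi.const_mul b)
    rw [mul_inv_cancel₀ hb, show -t + (1 - b + b) - 1 = -t by ring] at h1
    refine h1.congr fun z => ?_
    simp only [sigma, inv_div]
    ring

theorem sigma_limit_axis_y_eq_zero (hb : b ≠ 0) (hD : ∀ᶠ z in F, z ∈ sigmaDom) {x : ℝ} (hx0 : x ≠ 0)
    (h : F ≤ 𝓝 (x, 0)) : Tendsto (fun z => coords b (sigma z)) F (𝓝 (ptV4 1)) := by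
  have hx : Tendsto (fun z : ℝ × ℝ => z.1) F (𝓝 x) := (continuous_fst.tendsto (x, (0 : ℝ))).mono_left h
  have hy : Tendsto (fun z : ℝ × ℝ => z.2) F (𝓝 0) := (continuous_snd.tendsto (x, (0 : ℝ))).mono_left h
  refine tendsto_ptV4 hb ?_ ?_
  · refine (cobounded_add (cobounded_div_of_zero hx hx0 hy (hD.mono fun z hz => hz.2))
      (hx.const_sub 1)).congr fun z => ?_
    simp only [sigma]
    ring
  · simpa [sigma] using (hy.const_sub 1).add (hy.div hx hx0)

theorem sigma_limit_axis_x_eq_zero (hD : ∀ᶠ z in F, z ∈ sigmaDom) {y : ℝ} (hy0 : y ≠ 0)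
    (h : F ≤ 𝓝 (0, y)) : Tendsto (fun z => coords b (sigma z)) F (𝓝 (ptV3 (1 - y))) := by
  have hx : Tendsto (fun z : ℝ × ℝ => z.1) F (𝓝 0) := (continuous_fst.tendsto ((0 : ℝ), y)).mono_left h
  have hy : Tendsto (fun z : ℝ × ℝ => z.2) F (𝓝 y) := (continuous_snd.tendsto ((0 : ℝ), y)).mono_left h
  have hX : Tendsto (fun z => (sigma z).1) F (𝓝 1) := by
    simpa [sigma] using (hx.const_sub 1).add (hx.div hy hy0)
  refine tendsto_ptV3 hX ?_ ?_
  · refine (cobounded_add (cobounded_div_of_zero hy hy0 hx (hD.mono fun z hz => hz.1))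
      (hy.const_sub 1)).congr fun z => ?_
    simp only [sigma]
    ring
  · have h1 := ((hy.mul (hx.sub_const 1)).add
      ((hx.sub_const 1).neg.add (hX.sub_const 1))).congr' (hD.mono sigma_snd_mul)
    rwa [show y * (0 - 1) + (-(0 - 1) + (1 - 1)) = 1 - y by ring] at h1

end SigmaLimits

/-! ### The extension of `f` -/

section Extension

variable {a b : ℝ}

theorem exists_fMaps {p : XR b} {q : ProjFour}
    (h : Tendsto (fun z => coords b (sigma z)) (comap (incl b) (𝓝 p) ⊓ 𝓟 sigmaDom) (𝓝 q)) :
    ∃ r : XR b, r.1 = tauProj a b q ∧ FMaps a b p r := by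
  obtain ⟨r, hr, h⟩ := exists_isValue dense_sigmaDom h
  exact ⟨tauX a b r, by rw [← hr]; rfl, fMaps_of_sigma h⟩

theorem eventually_sigmaDom (p : XR b) :
    ∀ᶠ z in comap (incl b) (𝓝 p) ⊓ 𝓟 sigmaDom, z ∈ sigmaDom :=
  mem_inf_of_right (mem_principal_self _)

theorem tendsto_coords_of_eq {p : XR b} {q : ProjFour} (hp : p.1 = q) :
    Tendsto (coords b) (comap (incl b) (𝓝 p) ⊓ 𝓟 sigmaDom) (𝓝 q) :=
  hp ▸ (tendsto_coords_self p).mono_left inf_le_left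

theorem filter_le_nhds (z : ℝ × ℝ) : comap (incl b) (𝓝 (incl b z)) ⊓ 𝓟 sigmaDom ≤ 𝓝 z := by
  rw [← (isInducing_incl b).nhds_eq_comap]
  exact inf_le_left

theorem fMaps_V0 (hb : b ≠ 0) {p : XR b} {t : OnePoint ℝ} (hp : p.1 = ptV0 t) :
    ∃ q : XR b, q.1 = ptV0 (reflect b t) ∧ FMaps a b p q :=
  exists_fMaps (sigma_limit_V0 hb (eventually_sigmaDom p) (tendsto_coords_of_eq hp))

theorem fMaps_V2 {p : XR b} {t : ℝ} (hp : p.1 = ptV2 t) :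
    ∃ q : XR b, q.1 = ptV2 (1 - t) ∧ FMaps a b p q :=
  exists_fMaps (sigma_limit_V2 (eventually_sigmaDom p) (tendsto_coords_of_eq hp))

theorem fMaps_V3 {p : XR b} {s : ℝ} (hp : p.1 = ptV3 s) : FMaps a b p (incl b (0, a + s)) := by
  obtain ⟨q, hq, h⟩ := exists_fMaps (a := a)
    (sigma_limit_V3 (eventually_sigmaDom p) (tendsto_coords_of_eq hp))
  convert h
  refine Subtype.ext ?_
  rw [hq]
  refine Eq.trans ?_ (tauProj_coords a b _).symm
  change coords b _ = _
  congr 1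
  simp only [tau, Prod.mk.injEq, true_and]
  ring

theorem fMaps_V4 (hb : b ≠ 0) {p : XR b} {t : ℝ} (ht : t ≠ 1) (hp : p.1 = ptV4 t) :
    ∃ q : XR b, q.1 = ptV5 b (a + t) ∧ FMaps a b p q := by
  obtain ⟨q, hq, h⟩ := exists_fMaps (a := a)
    (sigma_limit_V4 hb (eventually_sigmaDom p) ht (tendsto_coords_of_eq hp))
  refine ⟨q, ?_, h⟩
  rw [hq, tauProj_ptV4]
  congr 1
  ring

theorem fMaps_V5 (hb : b ≠ 0) {p : XR b} {t : ℝ} (hp : p.1 = ptV5 b t) :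
    ∃ q : XR b, q.1 = ptV4 (a + 1 + t) ∧ FMaps a b p q := by
  obtain ⟨q, hq, h⟩ := exists_fMaps (a := a)
    (sigma_limit_V5 hb (tendsto_coords_of_eq hp))
  refine ⟨q, ?_, h⟩
  rw [hq, tauProj_ptV5]
  congr 1
  ring

theorem fMaps_y_eq_zero (hb : b ≠ 0) {x : ℝ} (hx : x ≠ 0) :
    ∃ q : XR b, q.1 = ptV5 b a ∧ FMaps a b (incl b (x, 0)) q := by
  obtain ⟨q, hq, h⟩ := exists_fMaps (a := a)
    (sigma_limit_axis_y_eq_zero hb (eventually_sigmaDom _) hx (filter_le_nhds (b := b) (x, 0)))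
  refine ⟨q, ?_, h⟩
  rw [hq, tauProj_ptV4]
  congr 1
  ring

theorem fMaps_x_eq_zero {y : ℝ} (hy : y ≠ 0) :
    ∃ q : XR b, q.1 = ptV3 (y - 1) ∧ FMaps a b (incl b (0, y)) q := by
  obtain ⟨q, hq, h⟩ := exists_fMaps (a := a)
    (sigma_limit_axis_x_eq_zero (eventually_sigmaDom _) hy (filter_le_nhds (b := b) (0, y)))
  refine ⟨q, ?_, h⟩
  rw [hq, tauProj_ptV3]
  congr 1
  ring

theorem fMaps_incl {z : ℝ × ℝ} (hz : z ∈ sigmaDom) :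
    FMaps a b (incl b z) (incl b (tau a b (sigma z))) := by
  have hc : ContinuousAt (fun z => tau a b (sigma z)) z := by
    obtain ⟨h1, h2⟩ := hz
    unfold tau sigma
    fun_prop (disch := assumption)
  exact ((continuous_incl b).tendsto _).comp (hc.tendsto.mono_left (filter_le_nhds z))

end Extension

variable {a b : ℝ}

/-! ### Orbits of the points at infinity and of the line `x = 0` -/

theorem forward_V0 (hb : b ≠ 0) {p : XR b} {t : OnePoint ℝ} (hp : p.1 = ptV0 t) :
    ForwardToInfinity a b p := by
  refine forward_of_invariant (S := {p | ∃ t, p.1 = ptV0 t}) ?_ ?_ ⟨t, hp⟩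
  · rintro p ⟨t, hp⟩
    exact mem_infinity_of_coord (Or.inl (by rw [hp]; rfl))
  · rintro p ⟨t, hp⟩
    obtain ⟨q, hq, h⟩ := fMaps_V0 (a := a) hb hp
    exact ⟨q, ⟨_, hq⟩, h⟩

theorem forward_V2 {p : XR b} {t : ℝ} (hp : p.1 = ptV2 t) : ForwardToInfinity a b p := by
  refine forward_of_invariant (S := {p | ∃ t, p.1 = ptV2 t}) ?_ ?_ ⟨t, hp⟩
  · rintro p ⟨t, hp⟩
    exact mem_infinity_of_coord (Or.inr (by rw [hp]; rfl))
  · rintro p ⟨t, hp⟩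
    obtain ⟨q, hq, h⟩ := fMaps_V2 (a := a) hp
    exact ⟨q, ⟨_, hq⟩, h⟩

/-- The points of `V₄` and `V₅` whose orbit avoids the indeterminate point of `V₄`. -/
def regularV45 (a b : ℝ) : Set (XR b) :=
  {p | ∃ t, (p.1 = ptV4 t ∧ ∀ k : ℕ, t + k * (2 * a + 1) ≠ 1) ∨
    (p.1 = ptV5 b t ∧ ∀ k : ℕ, t + a + 1 + k * (2 * a + 1) ≠ 1)}

/-- Two steps of f translate the parameter of V₄ by (a + 1) + a = 2a + 1, and the arithmetic
condition keeps every visit to V₄ away from 1. -/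
theorem forward_regularV45 (hb : b ≠ 0) {p : XR b} (hp : p ∈ regularV45 a b) :
    ForwardToInfinity a b p := by
  refine forward_of_invariant (S := regularV45 a b) ?_ ?_ hp
  · rintro p ⟨t, ⟨hp, -⟩ | ⟨hp, -⟩⟩ <;>
      exact mem_infinity_of_coord (Or.inl (by rw [hp]; rfl))
  · rintro p ⟨t, ⟨hp, h⟩ | ⟨hp, h⟩⟩
    · obtain ⟨q, hq, hf⟩ := fMaps_V4 (a := a) hb (by simpa using h 0) hp
      refine ⟨q, ⟨_, Or.inr ⟨hq, fun k => ?_⟩⟩, hf⟩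
      have := h (k + 1)
      push_cast at this
      convert this using 1
      ring
    · obtain ⟨q, hq, hf⟩ := fMaps_V5 (a := a) hb hp
      refine ⟨q, ⟨_, Or.inl ⟨hq, fun k => ?_⟩⟩, hf⟩
      convert h k using 1
      ring

/-- The orbit alternates between x = 0 and V₃. Its points on x = 0 drift to infinity by a − 1 every
two steps, and only the origin could stop it. -/
theorem forward_x_eq_zero (ha : a < -1) {y : ℝ} (hy : ∀ k : ℕ, y + k * (a - 1) ≠ 0) :
    ForwardToInfinity a b (incl b (0, y)) := by
  choose w hw hvw using fun n : ℕ => fMaps_x_eq_zero (a := a) (b := b) (hy n)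
  have := forward_of_alternating (v := fun n : ℕ => incl b (0, y + n * (a - 1))) hvw
    (fun n => ?_) ?_ ?_
  · simpa using this
  · have := fMaps_V3 (a := a) (hw n)
    convert this using 3
    push_cast
    ring
  · refine tendsto_infinity_of_cobounded ?_
    rw [← tendsto_norm_atTop_iff_cobounded]
    have h1 : Tendsto (fun n : ℕ => (n : ℝ) * (a - 1) + y) atTop atBot :=
      tendsto_atBot_add_const_right _ _
        (tendsto_natCast_atTop_atTop.atTop_mul_const_of_neg (by linarith))
    refine tendsto_atTop_mono (fun n => ?_) (tendsto_abs_atBot_atTop.comp h1)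
    refine le_trans (le_of_eq ?_) (norm_snd_le _)
    simp [add_comm]
  · refine Tendsto.mono_right ?_ principal_le_nhdsSet
    refine tendsto_principal.2 (Eventually.of_forall fun n => mem_infinity_of_coord (Or.inr ?_))
    rw [hw n]
    rfl

theorem nat_mul_ne (ha : a < -1) {y : ℝ} (hy : y < 0) (k : ℕ) : y + k * (a - 1) ≠ 0 := by
  have : (k : ℝ) * (1 - a) ≥ 0 := mul_nonneg k.cast_nonneg (by linarith)
  intro h
  linarith

/-- If both `y` and `y'` have an indeterminate point in their forward orbits on `x = 0`, they are
nonnegative. -/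
theorem forward_x_eq_zero_or (ha : a < -1) {y y' : ℝ} (h : y < 0 ∨ y' < 0) :
    ForwardToInfinity a b (incl b (0, y)) ∨ ForwardToInfinity a b (incl b (0, y')) :=
  h.imp (fun h => forward_x_eq_zero ha (nat_mul_ne ha h))
    fun h => forward_x_eq_zero ha (nat_mul_ne ha h)

theorem forward_or_backward_V3 (ha : a < -1) {p : XR b} {s : ℝ} (hp : p.1 = ptV3 s) :
    ForwardToInfinity a b p ∨ BackwardToInfinity a b p := by
  have hp' : (tauX a b p).1 = ptV3 (-s) := by
    rw [← tauProj_ptV3 a b, ← hp]; rfl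
  rw [backward_iff, forward_iff_of_fMaps (fMaps_V3 hp), forward_iff_of_fMaps (fMaps_V3 hp')]
  -- The images (0, a + s) and (0, a − s) have heights with sum 2a < 0, so one is negative.
  refine forward_x_eq_zero_or ha ?_
  by_contra! h
  linarith [h.1, h.2]

theorem ne_one_of_lt (ha : a < -1) {t : ℝ} (ht : t < 1) (k : ℕ) : t + k * (2 * a + 1) ≠ 1 := by
  have : (k : ℝ) * -(2 * a + 1) ≥ 0 := mul_nonneg k.cast_nonneg (by linarith)
  intro h
  linarith

theorem forward_or_backward_V4 (ha : a < -1) (hb : b ≠ 0) {p : XR b} {t : ℝ} (hp : p.1 = ptV4 t) :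
    ForwardToInfinity a b p ∨ BackwardToInfinity a b p := by
  have hp' : (tauX a b p).1 = ptV5 b (a + 1 - t) := by
    rw [← tauProj_ptV4 a b, ← hp]; rfl
  rw [backward_iff]
  by_cases ht : t < 1
  · exact Or.inl (forward_regularV45 hb ⟨t, Or.inl ⟨hp, ne_one_of_lt ha ht⟩⟩)
  -- The orbit of τp next meets V₄ at 2a + 2 − t, which is below 1 when t ≥ 1.
  · exact Or.inr (forward_regularV45 hb ⟨_, Or.inr ⟨hp', ne_one_of_lt ha (by linarith)⟩⟩)

theorem forward_or_backward_V5 (ha : a < -1) (hb : b ≠ 0) {p : XR b} {t : ℝ}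
    (hp : p.1 = ptV5 b t) : ForwardToInfinity a b p ∨ BackwardToInfinity a b p := by
  have h4 : (tauX a b p).1 = ptV4 (a + 1 - t) := by
    rw [← tauProj_ptV5 a b, ← hp]; rfl
  rcases forward_or_backward_V4 ha hb h4 with h | h
  · exact Or.inr (backward_iff.2 h)
  · rw [backward_iff, tauX_tauX] at h
    exact Or.inl h

/-! ### The dynamics off the critical curves -/

/-- The complement of the critical curves and the line `x = 0`. -/
def regularSet : Set (ℝ × ℝ) := {z | z.1 ≠ 0 ∧ z.2 ≠ 0 ∧ (z.1 - 1) * (z.2 - 1) ≠ 1}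

theorem regularSet_subset : regularSet ⊆ sigmaDom := fun _ hz => ⟨hz.1, hz.2.1⟩

theorem sigma_eq {z : ℝ × ℝ} (hz : z ∈ sigmaDom) :
    sigma z = ((1 - (z.1 - 1) * (z.2 - 1)) / z.2, (1 - (z.1 - 1) * (z.2 - 1)) / z.1) := by
  obtain ⟨h1, h2⟩ := hz
  refine Prod.ext ?_ ?_ <;> simp only [sigma] <;> field_simp <;> ring

/-- The pencil of conics (x − 1)(y − 1) = s is fixed member by member; this makes σ visibly an
involution in the form `sigma_eq`. -/
theorem sigma_invariant {z : ℝ × ℝ} (hz : z ∈ sigmaDom) :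
    ((sigma z).1 - 1) * ((sigma z).2 - 1) = (z.1 - 1) * (z.2 - 1) := by
  obtain ⟨h1, h2⟩ := hz
  simp only [sigma]
  field_simp
  ring

theorem sigma_mem_regularSet {z : ℝ × ℝ} (hz : z ∈ regularSet) : sigma z ∈ regularSet := by
  have hd := regularSet_subset hz
  have h : 1 - (z.1 - 1) * (z.2 - 1) ≠ 0 := sub_ne_zero.2 hz.2.2.symm
  refine ⟨?_, ?_, by rw [sigma_invariant hd]; exact hz.2.2⟩
  · rw [sigma_eq hd]; exact div_ne_zero h hz.2.1
  · rw [sigma_eq hd]; exact div_ne_zero h hz.1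

theorem sigma_sigma {z : ℝ × ℝ} (hz : z ∈ regularSet) : sigma (sigma z) = z := by
  have hd := regularSet_subset hz
  have h : 1 - (z.1 - 1) * (z.2 - 1) ≠ 0 := sub_ne_zero.2 hz.2.2.symm
  rw [sigma_eq (regularSet_subset (sigma_mem_regularSet hz)), sigma_invariant hd, sigma_eq hd]
  exact Prod.ext (div_div_cancel₀ h) (div_div_cancel₀ h)

/-- The point does not escape to infinity in either direction of time. -/
def Recurrent (a b : ℝ) (z : ℝ × ℝ) : Prop :=
  ¬ ForwardToInfinity a b (incl b z) ∧ ¬ ForwardToInfinity a b (incl b (tau a b z))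

theorem Recurrent.tau {z : ℝ × ℝ} (h : Recurrent a b z) : Recurrent a b (tau a b z) :=
  ⟨h.2, by rw [tau_tau]; exact h.1⟩

theorem Recurrent.mem_regularSet (ha : a < -1) (hb : b ≠ 0) {z : ℝ × ℝ} (h : Recurrent a b z) :
    z ∈ regularSet := by
  obtain ⟨x, y⟩ := z
  obtain ⟨h1, h2⟩ := h
  have hx : x ≠ 0 := by
    rintro rfl
    simp only [BirationalPlane.tau, mul_zero, zero_add] at h2
    -- The two heights have sum a + 1 < 0.
    rcases forward_x_eq_zero_or (b := b) ha (y := y) (y' := a + 1 - y)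
      (by by_contra! h; linarith [h.1, h.2]) with h | h
    · exact h1 h
    · exact h2 h
  have hy : y ≠ 0 := by
    rintro rfl
    obtain ⟨q, hq, hf⟩ := fMaps_y_eq_zero (a := a) hb hx
    exact h1 ((forward_iff_of_fMaps hf).2
      (forward_regularV45 hb ⟨a, Or.inr ⟨hq, ne_one_of_lt ha (by linarith)⟩⟩))
  refine ⟨hx, hy, fun hc => h1 ?_⟩
  have hf := fMaps_incl (a := a) (b := b) (z := (x, y)) ⟨hx, hy⟩
  rw [sigma_eq (z := (x, y)) ⟨hx, hy⟩] at hf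
  simp only [] at hc hf
  -- σ contracts the conic to the origin and τ moves that to (0, a + 1), which lies below the
  -- obstacle.
  rw [forward_iff_of_fMaps hf, hc]
  simp only [sub_self, zero_div, BirationalPlane.tau, mul_zero, zero_add, sub_zero]
  exact forward_x_eq_zero ha (nat_mul_ne ha (by linarith))

theorem Recurrent.tau_sigma (ha : a < -1) (hb : b ≠ 0) {z : ℝ × ℝ} (h : Recurrent a b z) :
    Recurrent a b (BirationalPlane.tau a b (sigma z)) := by
  have hz := h.mem_regularSet ha hb
  refine ⟨fun h' => h.1 ?_, fun h' => h.2 ?_⟩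
  · exact (forward_iff_of_fMaps (fMaps_incl (regularSet_subset hz))).2 h'
  · rw [tau_tau, forward_iff_of_fMaps (fMaps_incl (regularSet_subset (sigma_mem_regularSet hz))),
      sigma_sigma hz] at h'
    exact h'

theorem Recurrent.sigma_tau (ha : a < -1) (hb : b ≠ 0) {z : ℝ × ℝ} (h : Recurrent a b z) :
    Recurrent a b (sigma (BirationalPlane.tau a b z)) := by
  simpa using (h.tau.tau_sigma ha hb).tau

/-! ### The escaping regions -/

/-- The part of the third quadrant that escapes forward. -/
def leftTrap (a b : ℝ) : Set (ℝ × ℝ) := {z | z.1 < 0 ∧ z.2 < 0 ∧ (b < 0 ∨ z.2 < b * z.1 + a + 1)}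

/-- The part of the fourth quadrant that is exchanged with `leftTrap`. -/
def rightTrap (a b : ℝ) : Set (ℝ × ℝ) := {z | 1 < z.1 ∧ z.2 < 0 ∧ (0 < b ∨ z.2 < b * z.1 + a + 1)}

theorem leftTrap_subset : leftTrap a b ⊆ sigmaDom := fun _ hz => ⟨hz.1.ne, hz.2.1.ne⟩

theorem rightTrap_subset : rightTrap a b ⊆ sigmaDom :=
  fun _ hz => ⟨(zero_lt_one.trans hz.1).ne', hz.2.1.ne⟩

theorem tau_sigma_mem_rightTrap (ha : a < -1) {z : ℝ × ℝ} (hz : z ∈ leftTrap a b)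
    (hb : b ≠ 0) : tau a b (sigma z) ∈ rightTrap a b := by
  obtain ⟨x, y⟩ := z
  obtain ⟨hx, hy, h⟩ := hz
  simp only [] at hx hy h
  have h1 : 0 < x / y := div_pos_of_neg_of_neg hx hy
  have h2 : 0 < y / x := div_pos_of_neg_of_neg hy hx
  have hmul : x / y * (y / x) = 1 := by field_simp [hx.ne, hy.ne]
  simp only [rightTrap, tau, sigma, Set.mem_ofPred_eq]
  rcases lt_or_gt_of_ne hb with hb | hb
  · have h3 : 0 < -b * (1 - x + x / y) := mul_pos (by linarith) (by linarith)
    exact ⟨by linarith, by linarith, Or.inr (by linarith)⟩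
  · have h := h.resolve_left (not_lt.2 hb.le)
    refine ⟨by linarith, ?_, Or.inl hb⟩
    have key : b * (1 - x + x / y) + a + 1 - (1 - y + y / x) =
        (y - b * x) * (1 - 1 / x - 1 / y) + a + 1 := by
      have := hx.ne
      have := hy.ne
      field_simp
      ring
    rw [key]
    have h4 : 1 / x < 0 := one_div_neg.2 hx
    have h5 : 1 / y < 0 := one_div_neg.2 hy
    -- The first factor is below a + 1 < 0 and the second exceeds 1.
    nlinarith

theorem tau_sigma_mem_leftTrap (ha : a < -1) {z : ℝ × ℝ} (hz : z ∈ rightTrap a b)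
    (hb : b ≠ 0) : tau a b (sigma z) ∈ leftTrap a b := by
  obtain ⟨x, y⟩ := z
  obtain ⟨hx, hy, h⟩ := hz
  simp only [] at hx hy h
  have hx0 : 0 < x := by linarith
  have h1 : x / y < 0 := div_neg_of_pos_of_neg hx0 hy
  have h2 : y - y / x < 0 := by
    have : y - y / x = y * (x - 1) / x := by field_simp
    rw [this]
    exact div_neg_of_neg_of_pos (mul_neg_of_neg_of_pos hy (by linarith)) hx0
  simp only [leftTrap, tau, sigma, Set.mem_ofPred_eq]
  rcases lt_or_gt_of_ne hb with hb | hb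
  · refine ⟨by linarith, ?_, Or.inl hb⟩
    have h := h.resolve_left (not_lt.2 hb.le)
    have hm : y / x < b := by rw [div_lt_iff₀ hx0]; linarith
    have hbm : b * (x / y) < 1 := by
      rw [← mul_div_assoc, div_lt_one_of_neg hy]; linarith
    have key : b * (1 - x + x / y) + a + 1 - (1 - y + y / x) =
        (x - 1) * (y / x - b) + a + b * (x / y) := by
      have := hy.ne
      field_simp
      ring
    rw [key]
    -- The product is negative because y / x < b, and a + b (x / y) < a + 1 < 0.
    nlinarith
  · have h3 : b * (1 - x + x / y) < 0 := mul_neg_of_pos_of_neg hb (by linarith)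
    exact ⟨by linarith, by linarith, Or.inr (by linarith)⟩

/-- Two alternating sequences that are related by the first component of `f` and stay in the
third and fourth quadrants leave every compact set. -/
theorem cobounded_of_alternating {v w : ℕ → ℝ × ℝ} (hv : ∀ n, (v n).1 < 0 ∧ (v n).2 < 0)
    (hw : ∀ n, 1 < (w n).1 ∧ (w n).2 < 0)
    (hvw : ∀ n, (w n).1 = 1 - (v n).1 + (v n).1 / (v n).2)
    (hwv : ∀ n, (v (n + 1)).1 = 1 - (w n).1 + (w n).1 / (w n).2) :
    Tendsto v atTop (cobounded (ℝ × ℝ)) ∧ Tendsto w atTop (cobounded (ℝ × ℝ)) := by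
  have hp : ∀ n, 0 < (v n).1 / (v n).2 := fun n => div_pos_of_neg_of_neg (hv n).1 (hv n).2
  have hq : ∀ n, 0 < -((w n).1 / (w n).2) := fun n =>
    neg_pos.2 (div_neg_of_pos_of_neg (by linarith [(hw n).1]) (hw n).2)
  have hstep : ∀ n, (w (n + 1)).1 - (w n).1 =
      -((w n).1 / (w n).2) + (v (n + 1)).1 / (v (n + 1)).2 := fun n => by
    rw [hvw (n + 1)]
    nth_rewrite 1 [hwv n]
    ring
  -- Both terms of the increment are positive, so the x-coordinates on the right either diverge or
  -- converge.
  have hmono : Monotone fun n => (w n).1 :=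
    monotone_nat_of_le_succ fun n => by linarith [hstep n, hp (n + 1), hq n]
  have hbound : ∀ n, (w n).1 - 1 < -(v (n + 1)).1 := fun n => by
    linarith [hwv n, hq n]
  rw [← tendsto_add_atTop_iff_nat (f := v) 1]
  simp only [← tendsto_norm_atTop_iff_cobounded]
  rcases tendsto_atTop_of_monotone hmono with h | ⟨l, h⟩
  · constructor
    · refine tendsto_atTop_mono (fun n => ?_) (tendsto_atTop_add_const_right _ (-1) h)
      have h1 := norm_fst_le (v (n + 1))
      have h2 := neg_le_abs (v (n + 1)).1
      rw [Real.norm_eq_abs] at h1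
      linarith [hbound n]
    · refine tendsto_atTop_mono (fun n => ?_) h
      exact (le_abs_self _).trans (norm_fst_le (w n))
  -- If they converge, both ratios x / y tend to 0. As |x| stays bounded away from 0, |y| must
  -- diverge.
  · have hd : Tendsto (fun n => (w (n + 1)).1 - (w n).1) atTop (𝓝 0) := by
      simpa using (h.comp (tendsto_add_atTop_nat 1)).sub h
    have hq0 : Tendsto (fun n => -((w n).1 / (w n).2)) atTop (𝓝[>] 0) := by
      refine tendsto_nhdsWithin_iff.2 ⟨squeeze_zero (fun n => (hq n).le) (fun n => ?_) hd,
        Eventually.of_forall hq⟩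
      linarith [hstep n, hp (n + 1)]
    have hp0 : Tendsto (fun n => (v (n + 1)).1 / (v (n + 1)).2) atTop (𝓝[>] 0) := by
      refine tendsto_nhdsWithin_iff.2 ⟨squeeze_zero (fun n => (hp (n + 1)).le) (fun n => ?_) hd,
        Eventually.of_forall fun n => hp (n + 1)⟩
      linarith [hstep n, hq n]
    have hc : 0 < (w 0).1 - 1 := by linarith [(hw 0).1]
    constructor
    · refine tendsto_atTop_mono (fun n => ?_)
        ((tendsto_inv_nhdsGT_zero.comp hp0).const_mul_atTop hc)
      have h1 := norm_snd_le (v (n + 1))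
      rw [Real.norm_eq_abs, abs_of_neg (hv (n + 1)).2] at h1
      refine le_trans ?_ h1
      have h2 : (w 0).1 - 1 ≤ -(v (n + 1)).1 := by linarith [hmono (Nat.zero_le n), hbound n]
      refine (mul_le_mul_of_nonneg_right h2 (inv_nonneg.2 (hp (n + 1)).le)).trans (le_of_eq ?_)
      have := (hv (n + 1)).1.ne
      have := (hv (n + 1)).2.ne
      field_simp
    · refine tendsto_atTop_mono (fun n => ?_)
        ((tendsto_inv_nhdsGT_zero.comp hq0).const_mul_atTop zero_lt_one)
      have h1 := norm_snd_le (w n)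
      rw [Real.norm_eq_abs, abs_of_neg (hw n).2] at h1
      refine le_trans ?_ h1
      refine (mul_le_mul_of_nonneg_right (hw n).1.le (inv_nonneg.2 (hq n).le)).trans (le_of_eq ?_)
      have : (w n).1 ≠ 0 := by linarith [(hw n).1]
      have := (hw n).2.ne
      field_simp

theorem forward_leftTrap (ha : a < -1) (hb : b ≠ 0) {z : ℝ × ℝ} (hz : z ∈ leftTrap a b) :
    ForwardToInfinity a b (incl b z) := by
  let f : ℝ × ℝ → ℝ × ℝ := fun z => tau a b (sigma z)
  let v : ℕ → ℝ × ℝ := fun n => (fun z => f (f z))^[n] z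
  have hsucc : ∀ n, v (n + 1) = f (f (v n)) := fun n => Function.iterate_succ_apply' _ _ _
  have hv : ∀ n, v n ∈ leftTrap a b := fun n => by
    induction n with
    | zero => exact hz
    | succ n ih =>
      rw [hsucc]
      exact tau_sigma_mem_leftTrap ha (tau_sigma_mem_rightTrap ha ih hb) hb
  have hw : ∀ n, f (v n) ∈ rightTrap a b := fun n => tau_sigma_mem_rightTrap ha (hv n) hb
  obtain ⟨h1, h2⟩ := cobounded_of_alternating (v := v) (w := fun n => f (v n))
    (fun n => ⟨(hv n).1, (hv n).2.1⟩) (fun n => ⟨(hw n).1, (hw n).2.1⟩) (fun n => rfl)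
    (fun n => by rw [hsucc]; rfl)
  refine forward_of_alternating (v := fun n => incl b (v n)) (w := fun n => incl b (f (v n)))
    (fun n => fMaps_incl (leftTrap_subset (hv n))) (fun n => ?_)
    (tendsto_infinity_of_cobounded h1) (tendsto_infinity_of_cobounded h2)
  rw [hsucc]
  exact fMaps_incl (rightTrap_subset (hw n))

theorem forward_rightTrap (ha : a < -1) (hb : b ≠ 0) {z : ℝ × ℝ} (hz : z ∈ rightTrap a b) :
    ForwardToInfinity a b (incl b z) :=
  (forward_iff_of_fMaps (fMaps_incl (rightTrap_subset hz))).2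
    (forward_leftTrap ha hb (tau_sigma_mem_leftTrap ha hz hb))

/-- For `b > 0` the image of `R5` lies in the left trap. -/
theorem forward_R5 (ha : a < -1) (hb : 0 < b) {z : ℝ × ℝ} (hz : z ∈ R5) :
    ForwardToInfinity a b (incl b z) := by
  obtain ⟨hx, hy, hc⟩ := hz
  have hd : z ∈ sigmaDom := ⟨hx.ne', hy.ne⟩
  refine (forward_iff_of_fMaps (fMaps_incl hd)).2 (forward_leftTrap ha hb.ne' ?_)
  have h1 : (1 - (z.1 - 1) * (z.2 - 1)) / z.2 < 0 := div_neg_of_pos_of_neg (by linarith) hy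
  have h2 : 0 < (1 - (z.1 - 1) * (z.2 - 1)) / z.1 := div_pos (by linarith) hx
  have h3 := mul_neg_of_pos_of_neg hb h1
  rw [sigma_eq hd]
  refine ⟨h1, ?_, Or.inr ?_⟩ <;> simp only [tau] <;> linarith

/-- For b < 0, `R1` is inside the left trap and τ sends `R2` into the right one. For b > 0, f sends
`R5` into the left trap, and τ sends the second quadrant there. -/
theorem Recurrent.mem_codingRegion (ha : a < -1) (hb : b ≠ 0) {z : ℝ × ℝ}
    (h : Recurrent a b z) : z ∈ codingRegion b := by
  have hz : z ∈ R1 ∪ R2 ∪ R3 ∪ R4 ∪ R5 ∪ R6 ∪ R7 := by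
    rw [regions_cover]
    exact h.mem_regularSet ha hb
  rcases lt_or_gt_of_ne hb with hb' | hb'
  · refine Or.inr ⟨hb', ?_⟩
    have h1 : z ∉ R1 := fun h1 => h.1 (forward_leftTrap ha hb ⟨h1.1, h1.2, Or.inl hb'⟩)
    have h2 : z ∉ R2 := fun ⟨hx, hy, hc⟩ => by
      have hx1 : 1 < z.1 := by
        by_contra! hle
        nlinarith
      have hy1 : 1 < z.2 := by
        by_contra! hle
        nlinarith
      have hbx : b * z.1 < 0 := mul_neg_of_neg_of_pos hb' hx
      refine h.2 (forward_rightTrap ha hb ⟨hx1, ?_, Or.inr ?_⟩) <;>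
        simp only [BirationalPlane.tau] <;> linarith
    simp only [Set.mem_union] at hz ⊢
    tauto
  · refine Or.inl ⟨hb', ?_⟩
    have h5 : z ∉ R5 := fun h5 => h.1 (forward_R5 ha hb' h5)
    have h67 : ¬ (z.1 < 0 ∧ 0 < z.2) := fun ⟨hx, hy⟩ => by
      have hbx : b * z.1 < 0 := mul_neg_of_pos_of_neg hb' hx
      refine h.2 (forward_leftTrap ha hb ⟨hx, ?_, Or.inr ?_⟩) <;>
        simp only [BirationalPlane.tau] <;> linarith
    have h6 : z ∉ R6 := fun h6 => h67 ⟨h6.1, h6.2.1⟩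
    have h7 : z ∉ R7 := fun h7 => h67 ⟨h7.1, h7.2.1⟩
    simp only [Set.mem_union] at hz ⊢
    tauto

theorem Recurrent.mem_Omega (ha : a < -1) (hb : b ≠ 0) {z : ℝ × ℝ} (h : Recurrent a b z) :
    incl b z ∈ Omega a b := by
  refine Set.mem_iInter.2 fun n => ⟨?_, ?_⟩
  · induction n generalizing z with
    | zero => exact ⟨z, h.mem_codingRegion ha hb, rfl⟩
    | succ n ih =>
      rw [Function.iterate_succ_apply']
      -- The preimage f⁻¹z is again recurrent, so z is the image of a point of the n-th iterate.
      refine ⟨_, ih (h.sigma_tau ha hb), ?_⟩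
      have hz := h.tau.mem_regularSet ha hb
      have := fMaps_incl (a := a) (b := b) (regularSet_subset (sigma_mem_regularSet hz))
      rwa [sigma_sigma hz, tau_tau] at this
  · induction n generalizing z with
    | zero => exact ⟨z, h.mem_codingRegion ha hb, rfl⟩
    | succ n ih =>
      rw [Function.iterate_succ_apply']
      refine ⟨_, ih (h.tau_sigma ha hb), fInvMaps_iff.2 ?_⟩
      have hz := h.mem_regularSet ha hb
      have := fMaps_incl (a := a) (b := b) (regularSet_subset (sigma_mem_regularSet hz))
      rw [sigma_sigma hz] at this
      simpa using this

end BirationalPlane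

end

theorem theorem6p3 (a b : ℝ) (ha : a < -1) (hb : b ≠ 0) (p : BirationalPlane.XR b)
    (hp : p ∉ BirationalPlane.Omega a b) :
    BirationalPlane.ForwardToInfinity a b p ∨ BirationalPlane.BackwardToInfinity a b p := by
  open BirationalPlane in
  rcases point_cases hb p with ⟨z, rfl⟩ | ⟨t, h⟩ | ⟨t, h⟩ | ⟨s, h⟩ | ⟨t, h⟩ | ⟨t, h⟩
  · by_contra! hne
    rw [backward_iff, tauX_incl] at hne
    exact hp (Recurrent.mem_Omega ha hb hne)
  · exact Or.inl (forward_V0 hb h)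
  · exact Or.inl (forward_V2 h)
  · exact forward_or_backward_V3 ha h
  · exact forward_or_backward_V4 ha hb h
  · exact forward_or_backward_V5 ha hb h
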